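/- Let $n\ge 0$ and $\mathbb R[x]=\mathbb R[x_1,\dots,x_n]$. Let $S\subset\mathbb R[x]$ be a semiring, i.e. a subset that contains $0,1$ and is closed under addition and multiplication, and let $M\subset\mathbb R[x]$ be an $S$-module, i.e. $1\in M$, $M+M\subset M$ and $SM\subset M$; assume also $\mathbb Q_+M\subset M$, where $\mathbb Q_+$ is the set of nonnegative rationals. (The last condition holds automatically if $S$ contains $\mathbb Q_+$, in particular if $S$ contains all sums of squares.) A set $N\subset\mathbb R[x]$ that is closed under addition and contains $1$ is called archimedean if for every $a\in\mathbb R[x]$ there is a positive integer $k$ with $k-a\in N$. Assume that $M$ is archimedean, and that $S$ either is archimedean or is a preordering (i.e. contains all sums of squares in $\mathbb R[x]$). Write $X(M)=\{z\in\mathbb R^n: p(z)\ge 0 \text{ for all } p\in M\}$. Let $f\in\mathbb R[x]$ with $f\ge 0$ on $X(M)$, and let $Z(f)=\{z\in\mathbb R^n: f(z)=0\}$. Let $V\subset\mathbb A^n$ be the (reduced) Zariski closure of $Z(f)\cap X(M)$, with vanishing ideal $J\subset\mathbb R[x]$. Write $D_vp(z)=\lim_{t\to0}\frac{p(z+tv)-p(z)}{t}$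 for the directional derivative of $p$ at $z$ in the direction $v\in\mathbb R^n$, and $T_z(V)=\{v\in\mathbb R^n: D_vp(z)=0\text{ for all }p\in J\}$ for the tangent space of $V$ at $z$. Suppose there are $g_1,\dots,g_r\in S$ vanishing on $Z(f)\cap X(M)$ such that 1. $f$ lies in the ideal $(g_1,\dots,g_r)$ of $\mathbb R[x]$; 2. for every $z\in Z(f)\cap X(M)$ and every $v\in\mathbb R^n$ with $D_vg_i(z)\ge 0$ for $i=1,\dots,r$ and $v\notin T_z(V)$, one has $D_vf(z)>0$. Suppose moreover that every point $z\in Z(f)\cap X(M)$ is a nonsingular point of $V$, i.e. the localization of $\mathbb R[x]/J$ at the maximal ideal of $z$ is a regular local ring. Then $f\in M$. -/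

import Mathlib

namespace ArchPos

/-- An additive semigroup `M ∋ 1` in a ring `A` is archimedean if for every `a ∈ A`
there is a natural number `N` with `N - a ∈ M`. -/
def IsArchimedean {A : Type*} [CommRing A] (M : Set A) : Prop :=
  ∀ a : A, ∃ N : ℕ, (N : A) - a ∈ M

/-- A semiring in `A` is a preordering if it contains all sums of squares. -/
def IsPreordering {A : Type*} [CommRing A] (S : Subsemiring A) : Prop :=
  ∀ a : A, IsSumSq a → a ∈ S

variable {n : ℕ}

/-- `X(M)`: the points of `ℝⁿ` in which all elements of `M` are nonnegative. -/
def nonnegSet (M : Set (MvPolynomial (Fin n) ℝ)) : Set (Fin n → ℝ) :=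
  {x | ∀ p ∈ M, 0 ≤ MvPolynomial.eval x p}

/-- `Z(f)`: the real zeros of `f`. -/
def zeroSet (f : MvPolynomial (Fin n) ℝ) : Set (Fin n → ℝ) :=
  {x | MvPolynomial.eval x f = 0}

/-- `D_v f(z)`: the directional derivative of `f` at `z` in the direction `v`. -/
noncomputable def dirDeriv (v : Fin n → ℝ) (f : MvPolynomial (Fin n) ℝ) (z : Fin n → ℝ) : ℝ :=
  lineDeriv ℝ (fun x : Fin n → ℝ => MvPolynomial.eval x f) z v

/-- The set of real points of the (reduced) Zariski closure of a subset of `ℝⁿ`. The closure is a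
real variety whose real points are Zariski dense, so it is determined by this set; its coordinate
ring is the quotient of the polynomial ring by the vanishing ideal of the set. -/
def zariskiClosure (Z : Set (Fin n → ℝ)) : Set (Fin n → ℝ) :=
  MvPolynomial.zeroLocus ℝ (MvPolynomial.vanishingIdeal ℝ Z)

/-- The tangent space `T_z(V) ⊆ ℝⁿ` at `z`, for the reduced affine variety `V` whose ideal is the
vanishing ideal of the given set of real points. -/
def tangentSpace (V : Set (Fin n → ℝ)) (z : Fin n → ℝ) : Set (Fin n → ℝ) :=
  {v | ∀ p ∈ MvPolynomial.vanishingIdeal ℝ V, dirDeriv v p z = 0}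

/-- For a point `z` at which all elements of the ideal `J` vanish, the prime (in fact maximal) ideal
of `ℝ[x]/J` consisting of the classes of polynomials vanishing at `z`. -/
noncomputable def pointIdeal (J : Ideal (MvPolynomial (Fin n) ℝ)) (z : Fin n → ℝ)
    (hz : ∀ p ∈ J, MvPolynomial.eval z p = 0) : Ideal (MvPolynomial (Fin n) ℝ ⧸ J) :=
  RingHom.ker (Ideal.Quotient.lift J (MvPolynomial.eval z) hz)

instance pointIdeal_isPrime (J : Ideal (MvPolynomial (Fin n) ℝ)) (z : Fin n → ℝ)
    (hz : ∀ p ∈ J, MvPolynomial.eval z p = 0) : (pointIdeal J z hz).IsPrime :=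
  RingHom.ker_isPrime (Ideal.Quotient.lift J (MvPolynomial.eval z) hz)

/-- `z` is a nonsingular point of the reduced affine variety `V` whose ideal is the vanishing ideal
`J` of the given set of real points: `z` lies on `V`, and the local ring of `V` at `z`, that is the
localization of `ℝ[x]/J` at the maximal ideal of `z`, is a regular local ring. -/
def IsNonsingularPoint (V : Set (Fin n → ℝ)) (z : Fin n → ℝ) : Prop :=
  ∃ hz : ∀ p ∈ MvPolynomial.vanishingIdeal ℝ V, MvPolynomial.eval z p = 0,
    IsRegularLocalRing
      (Localization.AtPrime (pointIdeal (MvPolynomial.vanishingIdeal ℝ V) z hz))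

end ArchPos

/-! Work in the ideal `I = (g₁,…,g_r)`, which contains `f`, ordered by the cone `M ∩ I`. Since `M`
is archimedean and the `gᵢ` lie in `S`, the sum `u = ∑ gᵢ` is an order unit of this cone. If `f ∉
M`, separation and a Krein-Milman argument give an extreme state `φ` of `(I, M ∩ I, u)` with `φ f ≤
0` (`exists_extreme_state_nonpos`).

Extremality forces `φ (a b) = Φ a * φ b` for a ring homomorphism `Φ` that is nonnegative on `M`
(`exists_ringHom_of_extreme`), and `Φ` is evaluation at a point `z ∈ X(M)`. If `f z > 0`, then
computing `φ (f u)` in two ways gives `f z = u z * φ f ≤ 0`, a contradiction.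

If `f z = 0`, then `φ` kills `𝔪I`, where `𝔪` is the maximal ideal of `z`. Nonsingularity and the
derivative condition show that `I ∩ 𝔪²` lies locally in `𝔪I`, so `φ` only sees gradients at `z`: it
is a directional derivative `D_v` on `I` (`exists_eq_gradAt`). Now `D_v gᵢ = φ gᵢ ≥ 0`, while `D_v u
= 1` makes `v` non-tangent, so the derivative condition yields `φ f = D_v f > 0`, again a
contradiction. -/

namespace ArchPos

/-! ### States of rational cones with an order unit -/

section States

variable {E : Type*} [AddCommGroup E]

theorem additive_sub {φ : E → ℝ} (hφ : ∀ x y, φ (x + y) = φ x + φ y) (x y : E) :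
    φ (x - y) = φ x - φ y :=
  map_sub (AddMonoidHom.mk' φ hφ) x y

variable [Module ℚ E]

/-- The states of `E` with respect to the rational cone `C` and the element `u`. -/
def states (C : PointedCone ℚ E) (u : E) : Set (E → ℝ) :=
  {φ | (∀ x y, φ (x + y) = φ x + φ y) ∧ (∀ c ∈ C, 0 ≤ φ c) ∧ φ u = 1}

theorem smul_mem_cone {C : PointedCone ℚ E} {x : E} (hx : x ∈ C) {q : ℚ} (hq : 0 ≤ q) :
    q • x ∈ C :=
  Submodule.smul_mem C (⟨q, hq⟩ : {c : ℚ // 0 ≤ c}) hx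

theorem exists_maximal_cone (C : PointedCone ℚ E) {v : E} (hv : v ∉ C) :
    ∃ P : PointedCone ℚ E, C ≤ P ∧ Maximal (fun Q : PointedCone ℚ E => v ∉ Q) P := by
  refine zorn_le_nonempty₀ {Q : PointedCone ℚ E | v ∉ Q} ?_ C hv
  intro c hc hchain y hy
  refine ⟨sSup c, ?_, fun z hz => le_sSup hz⟩
  intro hmem
  rw [Submodule.mem_sSup_of_directed ⟨y, hy⟩ hchain.directedOn] at hmem
  obtain ⟨z, hz, hvz⟩ := hmem
  exact hc hz hvz

theorem exists_add_smul_of_maximal {P : PointedCone ℚ E} {v : E}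
    (hP : Maximal (fun Q : PointedCone ℚ E => v ∉ Q) P) {x : E} (hx : x ∉ P) :
    ∃ p ∈ P, ∃ q : ℚ, 0 ≤ q ∧ v = p + q • x := by
  by_contra! h
  refine hx (hP.2 (y := P ⊔ Submodule.span _ {x}) ?_ le_sup_left
    (Submodule.mem_sup_right (Submodule.mem_span_singleton_self x)))
  intro hv
  obtain ⟨p, hp, y, hy, rfl⟩ := Submodule.mem_sup.1 hv
  obtain ⟨q, rfl⟩ := Submodule.mem_span_singleton.1 hy
  exact h p hp q.1 q.2 rfl

/-- If neither holds, maximality gives `-u = p + a x = q - b x` with `p, q ∈ P`. Weighting by `b`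
and `a` eliminates `x` and puts `-u` into `P`. -/
theorem mem_or_neg_mem_of_maximal {P : PointedCone ℚ E} {u : E}
    (hP : Maximal (fun Q : PointedCone ℚ E => -u ∉ Q) P) (x : E) : x ∈ P ∨ -x ∈ P := by
  by_contra! h
  obtain ⟨p, hp, a, ha, hpa⟩ := exists_add_smul_of_maximal hP h.1
  obtain ⟨q, hq, b, hb, hqb⟩ := exists_add_smul_of_maximal hP h.2
  have ha0 : 0 < a := lt_of_le_of_ne ha (by
    rintro rfl; exact hP.1 (by rw [hpa]; simpa using hp))
  have key : (a + b) • (-u) = b • p + a • q := by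
    have : (a + b) • (-u) = b • (-u) + a • (-u) := by rw [add_smul, add_comm]
    rw [this]
    nth_rewrite 1 [hpa]
    rw [hqb]
    simp only [smul_add, smul_neg, smul_smul, mul_comm a b]
    abel
  refine hP.1 ?_
  have h2 : -u = (a + b)⁻¹ • (b • p + a • q) := by
    rw [← key, smul_smul, inv_mul_cancel₀ (by positivity), one_smul]
  rw [h2]
  exact smul_mem_cone (add_mem (smul_mem_cone hp hb) (smul_mem_cone hq ha)) (by positivity)

/-- The state is a Dedekind cut: `φ x` is the supremum of the rationals `q` with `x - q u ∈ P`. Such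
a supremum is superadditive for any cone; totality supplies `-φ y ≤ φ (-y)`, which upgrades this to
additivity. -/
theorem exists_state_of_total {P : PointedCone ℚ E} {u : E}
    (hu : ∀ x, ∃ N : ℕ, (N : ℚ) • u - x ∈ P)
    (hneg : -u ∉ P) (htot : ∀ x, x ∈ P ∨ -x ∈ P) : (states P u).Nonempty := by
  have hnn : ∀ q : ℚ, q • u ∈ P → 0 ≤ q := by
    intro q hq
    by_contra! hlt
    refine hneg ?_
    have : -u = (-q)⁻¹ • (q • u) := by
      rw [smul_smul, inv_neg, neg_mul, inv_mul_cancel₀ hlt.ne, neg_one_smul]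
    rw [this]
    exact smul_mem_cone hq (inv_nonneg.2 (by linarith))
  have hup : u ∈ P := (htot u).resolve_right hneg
  let L : E → Set ℝ := fun x => {r | ∃ q : ℚ, r = q ∧ x - q • u ∈ P}
  have hne : ∀ x, (L x).Nonempty := by
    intro x
    obtain ⟨N, hN⟩ := hu (-x)
    refine ⟨((-N : ℚ) : ℝ), -N, rfl, ?_⟩
    convert hN using 1
    rw [neg_smul]; abel
  have hbd : ∀ x, BddAbove (L x) := by
    intro x
    obtain ⟨N, hN⟩ := hu x
    refine ⟨N, ?_⟩
    rintro _ ⟨q, rfl, hq⟩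
    have h := hnn (N - q) (by convert add_mem hN hq using 1; rw [sub_smul]; abel)
    have : q ≤ N := by linarith
    exact_mod_cast this
  let φ : E → ℝ := fun x => sSup (L x)
  have hle : ∀ x (q : ℚ), x - q • u ∈ P → (q : ℝ) ≤ φ x := fun x q hq =>
    le_csSup (hbd x) ⟨q, rfl, hq⟩
  have hsuper : ∀ x y, φ x + φ y ≤ φ (x + y) := by
    intro x y
    rw [← le_sub_iff_add_le]
    refine csSup_le (hne x) ?_
    rintro _ ⟨q, rfl, hq⟩
    rw [le_sub_comm]
    refine csSup_le (hne y) ?_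
    rintro _ ⟨r, rfl, hr⟩
    rw [le_sub_iff_add_le]
    have := hle (x + y) (r + q) (by
      convert add_mem hq hr using 1; rw [add_smul]; abel)
    exact_mod_cast this
  have hnegφ : ∀ y, -φ y ≤ φ (-y) := by
    intro y
    rw [neg_le]
    refine le_of_forall_gt_imp_ge_of_dense fun a ha => ?_
    obtain ⟨q, hq1, hq2⟩ := exists_rat_btwn ha
    have hq : y - q • u ∉ P := fun h => absurd (hle y q h) (not_le.2 hq1)
    have h2 := (htot _).resolve_left hq
    have := hle (-y) (-q) (by convert h2 using 1; rw [neg_smul]; abel)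
    push_cast at this
    linarith
  refine ⟨φ, ?_, ?_, ?_⟩
  · intro x y
    refine le_antisymm ?_ (hsuper x y)
    have h1 := hsuper (x + y) (-y)
    rw [add_neg_cancel_right] at h1
    linarith [hnegφ y]
  · intro c hc
    have := hle c 0 (by simpa using hc)
    simpa using this
  · refine le_antisymm ?_ ?_
    · refine csSup_le (hne u) ?_
      rintro _ ⟨q, rfl, hq⟩
      have h := hnn (1 - q) (by rwa [sub_smul, one_smul])
      have : q ≤ 1 := by linarith
      exact_mod_cast this
    · have := hle u 1 (by simp)
      simpa using this

/-- Adjoining `-f` to `C` still omits `-u`, since `-u = c - q f` with `q > 0` would give `f = q⁻¹ (c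
+ u) ∈ C`. A state of a maximal cone omitting `-u` above it is then nonnegative at `-f`. -/
theorem exists_state_nonpos {C : PointedCone ℚ E} {u f : E}
    (hu : ∀ x, ∃ N : ℕ, (N : ℚ) • u - x ∈ C) (huC : u ∈ C) (hf : f ∉ C) :
    ∃ φ ∈ states C u, φ f ≤ 0 := by
  have h1 : -u ∉ C := by
    intro h
    obtain ⟨N, hN⟩ := hu (-f)
    refine hf ?_
    have := add_mem hN (smul_mem_cone h (Nat.cast_nonneg (α := ℚ) N))
    convert this using 1
    rw [smul_neg]; abel
  have h2 : -u ∉ C ⊔ Submodule.span {c : ℚ // 0 ≤ c} {-f} := by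
    intro h
    obtain ⟨c, hc, y, hy, h⟩ := Submodule.mem_sup.1 h
    obtain ⟨⟨q, hq⟩, rfl⟩ := Submodule.mem_span_singleton.1 hy
    change c + q • (-f) = -u at h
    have hq0 : 0 < q := lt_of_le_of_ne hq (by
      rintro rfl; exact h1 (by rw [← h]; simpa using hc))
    refine hf ?_
    have h3 : f = q⁻¹ • (c + u) := by
      have : q • f = c + u := by
        rw [smul_neg] at h
        have h' : u = q • f - c := by rw [← neg_neg u, ← h]; abel
        rw [h']; abel
      rw [← this, smul_smul, inv_mul_cancel₀ hq0.ne', one_smul]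
    rw [h3]
    exact smul_mem_cone (add_mem hc huC) (by positivity)
  obtain ⟨P, hCP, hP⟩ := exists_maximal_cone _ h2
  have hC : C ≤ P := le_sup_left.trans hCP
  obtain ⟨φ, hadd, hpos, h1⟩ := exists_state_of_total (fun x => (hu x).imp fun N h => hC h) hP.1
    (mem_or_neg_mem_of_maximal hP)
  refine ⟨φ, ⟨hadd, fun c hc => hpos c (hC hc), h1⟩, ?_⟩
  have h3 : 0 ≤ φ (-f) :=
    hpos _ (hCP (Submodule.mem_sup_right (Submodule.mem_span_singleton_self _)))
  have h4 := hadd f (-f)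
  have h5 := hadd 0 0
  rw [add_neg_cancel] at h4
  rw [add_zero] at h5
  linarith

theorem additive_natCast_smul {φ : E → ℝ} (hφ : ∀ x y, φ (x + y) = φ x + φ y) (N : ℕ) (x : E) :
    φ ((N : ℚ) • x) = N * φ x := by
  rw [Nat.cast_smul_eq_nsmul]
  simpa using map_nsmul (AddMonoidHom.mk' φ hφ) N x

theorem isCompact_states {C : PointedCone ℚ E} {u : E}
    (hu : ∀ x, ∃ N : ℕ, (N : ℚ) • u - x ∈ C) : IsCompact (states C u) := by
  choose N hN using hu
  refine IsCompact.of_isClosed_subset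
    (isCompact_univ_pi fun x : E => isCompact_Icc (a := -(N (-x) : ℝ)) (b := N x)) ?_ ?_
  · simp only [states, Set.ofPred_and, Set.ofPred_forall]
    refine IsClosed.inter (isClosed_iInter fun x => isClosed_iInter fun y =>
      isClosed_eq (by fun_prop) (by fun_prop)) (IsClosed.inter (isClosed_iInter fun x =>
      isClosed_iInter fun _ => isClosed_le (by fun_prop) (by fun_prop))
      (isClosed_eq (by fun_prop) (by fun_prop)))
  · rintro φ ⟨hadd, hpos, h1⟩ x -
    have key : ∀ x, φ x ≤ N x := by
      intro x
      have := hpos _ (hN x)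
      rw [additive_sub hadd, additive_natCast_smul hadd, h1] at this
      linarith
    refine ⟨?_, key x⟩
    have h2 := key (-x)
    have h3 : φ (-x) = -φ x := map_neg (AddMonoidHom.mk' φ hadd) x
    linarith

theorem exists_extreme_state_nonpos {C : PointedCone ℚ E} {u f : E}
    (hu : ∀ x, ∃ N : ℕ, (N : ℚ) • u - x ∈ C) (huC : u ∈ C) (hf : f ∉ C) :
    ∃ φ ∈ (states C u).extremePoints ℝ, φ f ≤ 0 := by
  obtain ⟨φ₀, hφ₀, hf₀⟩ := exists_state_nonpos hu huC hf
  obtain ⟨φ₁, hφ₁, hmin⟩ := (isCompact_states hu).exists_isMinOn ⟨φ₀, hφ₀⟩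
    (f := fun φ : E → ℝ => φ f) (by fun_prop)
  have hmin' : ∀ ψ ∈ states C u, φ₁ f ≤ ψ f := fun ψ hψ => hmin hψ
  -- The states minimizing the value at `f` form a compact face, so an extreme point of `B` is
  -- extreme among all states.
  let B : Set (E → ℝ) := {φ | φ ∈ states C u ∧ φ f = φ₁ f}
  have hBcl : IsCompact B :=
    (isCompact_states hu).inter_right (isClosed_eq (continuous_apply f) continuous_const)
  obtain ⟨φ, hφ⟩ := hBcl.extremePoints_nonempty ⟨φ₁, hφ₁, rfl⟩
  refine ⟨φ, ⟨hφ.1.1, ?_⟩, ?_⟩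
  · rintro ψ₁ h₁ ψ₂ h₂ hseg
    have h := hseg
    obtain ⟨a, b, ha, hb, hab, hc⟩ := h
    have e : a * ψ₁ f + b * ψ₂ f = φ₁ f := by
      rw [← hφ.1.2, ← hc]; simp
    have e' : a * φ₁ f + b * φ₁ f = φ₁ f := by rw [← add_mul, hab, one_mul]
    have k1 := hmin' ψ₁ h₁
    have k2 := hmin' ψ₂ h₂
    have e1 : ψ₁ f = φ₁ f := by
      refine le_antisymm ?_ k1
      by_contra! hlt
      nlinarith [mul_pos ha (sub_pos.2 hlt), mul_nonneg hb.le (sub_nonneg.2 k2)]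
    have e2 : ψ₂ f = φ₁ f := by
      refine le_antisymm ?_ k2
      by_contra! hlt
      nlinarith [mul_pos hb (sub_pos.2 hlt), mul_nonneg ha.le (sub_nonneg.2 k1)]
    exact hφ.2 ⟨h₁, e1⟩ ⟨h₂, e2⟩ hseg
  · rw [hφ.1.2]
    exact (hmin' φ₀ hφ₀).trans hf₀

theorem eq_zero_of_apply_unit_eq_zero {C : PointedCone ℚ E} {u : E}
    (hu : ∀ x, ∃ N : ℕ, (N : ℚ) • u - x ∈ C) {ψ : E → ℝ}
    (hadd : ∀ x y, ψ (x + y) = ψ x + ψ y) (hpos : ∀ c ∈ C, 0 ≤ ψ c) (h0 : ψ u = 0) (x : E) :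
    ψ x = 0 := by
  have key : ∀ x, ψ x ≤ 0 := by
    intro x
    obtain ⟨N, hN⟩ := hu x
    have := hpos _ hN
    rw [additive_sub hadd, additive_natCast_smul hadd, h0] at this
    linarith
  have h3 : ψ (-x) = -ψ x := map_neg (AddMonoidHom.mk' ψ hadd) x
  linarith [key x, key (-x)]

/-- A positive additive functional dominated by an extreme state is a multiple of it. -/
theorem eq_mul_of_dominated {C : PointedCone ℚ E} {u : E}
    (hu : ∀ x, ∃ N : ℕ, (N : ℚ) • u - x ∈ C) (huC : u ∈ C) {φ : E → ℝ}
    (hφ : φ ∈ (states C u).extremePoints ℝ) {ψ : E → ℝ} {t : ℝ} (ht : 0 < t)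
    (hadd : ∀ x y, ψ (x + y) = ψ x + ψ y) (hpos : ∀ c ∈ C, 0 ≤ ψ c)
    (hdom : ∀ c ∈ C, ψ c ≤ t * φ c) (x : E) : ψ x = ψ u * φ x := by
  obtain ⟨hφadd, hφpos, hφ1⟩ := hφ.1
  let χ : E → ℝ := fun x => t * φ x - ψ x
  have hχadd : ∀ x y, χ (x + y) = χ x + χ y := by
    intro x y; simp only [χ, hφadd, hadd]; ring
  have hχpos : ∀ c ∈ C, 0 ≤ χ c := fun c hc => sub_nonneg.2 (hdom c hc)
  have hψu := hpos u huC
  have hχu := hχpos u huC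
  have hsum : ψ u + χ u = t := by simp only [χ, hφ1]; ring
  rcases hψu.eq_or_lt with h0 | h0
  · rw [eq_zero_of_apply_unit_eq_zero hu hadd hpos h0.symm, ← h0, zero_mul]
  rcases hχu.eq_or_lt with h1 | h1
  · have := eq_zero_of_apply_unit_eq_zero hu hχadd hχpos h1.symm x
    have e : ψ u = t := by linarith
    simp only [χ] at this
    rw [e]; linarith
  -- Both `ψ` and `χ = t φ - ψ` are positive and nonzero at `u`; normalized, they are states having
  -- `φ` as a convex combination, so extremality applies.
  have hs1 : (ψ u)⁻¹ • ψ ∈ states C u := by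
    refine ⟨fun x y => ?_, fun c hc => ?_, ?_⟩
    · simp only [Pi.smul_apply, smul_eq_mul, hadd]; ring
    · exact mul_nonneg (inv_nonneg.2 h0.le) (hpos c hc)
    · exact inv_mul_cancel₀ h0.ne'
  have hs2 : (χ u)⁻¹ • χ ∈ states C u := by
    refine ⟨fun x y => ?_, fun c hc => ?_, ?_⟩
    · simp only [Pi.smul_apply, smul_eq_mul, hχadd]; ring
    · exact mul_nonneg (inv_nonneg.2 h1.le) (hχpos c hc)
    · exact inv_mul_cancel₀ h1.ne'
  have hseg : φ ∈ openSegment ℝ ((ψ u)⁻¹ • ψ) ((χ u)⁻¹ • χ) := by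
    refine ⟨ψ u / t, χ u / t, by positivity, by positivity, ?_, ?_⟩
    · rw [← add_div, hsum, div_self ht.ne']
    · ext y
      have e : ψ u / t * ((ψ u)⁻¹ * ψ y) + χ u / t * ((χ u)⁻¹ * χ y) = (ψ y + χ y) / t := by
        field_simp
      simp only [Pi.add_apply, Pi.smul_apply, smul_eq_mul]
      rw [e]
      simp only [χ]
      field_simp
      ring
  have := congrFun (hφ.2 hs1 hs2 hseg) x
  rw [← this]
  simp only [Pi.smul_apply, smul_eq_mul]
  field_simp

end States

/-! ### Regular quotients of regular local rings -/

section RegularLocal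

open IsLocalRing

universe u v

theorem isLocalRing_quotient {R : Type u} [CommRing R] [IsLocalRing R] {K : Ideal R}
    (hK : K ≤ maximalIdeal R) : IsLocalRing (R ⧸ K) :=
  haveI : Nontrivial (R ⧸ K) := Ideal.Quotient.nontrivial_iff.2
    (fun h => (maximalIdeal.isMaximal R).ne_top (top_le_iff.1 (h ▸ hK)))
  IsLocalRing.of_surjective' (Ideal.Quotient.mk K) Ideal.Quotient.mk_surjective

/-- Exchange argument: as `x ∉ 𝔪²`, some coefficient of `x` in a minimal generating set is a unit,
so `x` can replace that generator. -/
theorem exists_finset_maximalIdeal_quotient_singleton {R : Type u} [CommRing R] [IsLocalRing R]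
    [IsNoetherianRing R] {x : R} (hx : x ∈ maximalIdeal R) (hx2 : x ∉ maximalIdeal R ^ 2) :
    ∃ s : Finset R, s.card + 1 = (maximalIdeal R).spanFinrank ∧
      maximalIdeal R = Ideal.span (s : Set R) ⊔ Ideal.span {x} := by
  classical
  obtain ⟨s, hcard, hs⟩ := Submodule.FG.exists_span_finset_card_eq_spanFinrank
    (maximalIdeal R).fg_of_isNoetherianRing
  have hmem : ∀ y ∈ s, y ∈ maximalIdeal R := fun y hy => hs ▸ Submodule.subset_span hy
  obtain ⟨a, -, ha⟩ := Submodule.mem_span_finset.1 (hs.symm ▸ hx)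
  obtain ⟨t, ht, hat⟩ : ∃ t ∈ s, a t ∉ maximalIdeal R := by
    by_contra! h
    refine hx2 ?_
    rw [← ha, pow_two]
    exact sum_mem fun i hi => Ideal.mul_mem_mul (h i hi) (hmem i hi)
  have hu : IsUnit (a t) := by simpa using hat
  refine ⟨s.erase t, ?_, ?_⟩
  · rw [Finset.card_erase_add_one ht, hcard]
  · refine le_antisymm ?_ (sup_le (Ideal.span_le.2 fun y hy =>
      hmem y (Finset.mem_of_mem_erase hy)) ((Ideal.span_singleton_le_iff_mem _).2 hx))
    conv_lhs => rw [← hs]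
    refine Submodule.span_le.2 fun y hy => ?_
    by_cases hyt : y = t
    · subst hyt
      obtain ⟨b, hb⟩ := hu.exists_left_inv
      have e : y = b * x - b * ∑ i ∈ s.erase y, a i • i := by
        rw [← ha, ← Finset.add_sum_erase s _ ht, smul_eq_mul]
        linear_combination (-y) * hb
      have h : b * x - b * ∑ i ∈ s.erase y, a i • i ∈
          Ideal.span ((s.erase y : Finset R) : Set R) ⊔ Ideal.span {x} :=
        sub_mem (Ideal.mul_mem_left _ _ (Ideal.mem_sup_right
          (Ideal.mem_span_singleton_self x))) (Ideal.mul_mem_left _ _ (sum_mem fun i hi =>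
            Ideal.mul_mem_left _ _ (Ideal.mem_sup_left (Ideal.subset_span hi))))
      rwa [← e] at h
    · exact Ideal.mem_sup_left (Ideal.subset_span (Finset.mem_erase.2 ⟨hyt, hy⟩))

/-- Dividing by `x` lowers the number of generators of `𝔪` by at least one and the dimension by at
most one, so regularity persists. -/
theorem isRegularLocalRing_quotient_singleton {R : Type u} [CommRing R] [IsRegularLocalRing R]
    {d : ℕ} (hd : ringKrullDim R = d) {x : R} (hx : x ∈ maximalIdeal R)
    (hx2 : x ∉ maximalIdeal R ^ 2) :
    IsRegularLocalRing (R ⧸ Ideal.span {x}) ∧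
      ∃ e < d, ringKrullDim (R ⧸ Ideal.span {x}) = (e : ℕ) := by
  classical
  have hxm : Ideal.span {x} ≤ maximalIdeal R := (Ideal.span_singleton_le_iff_mem _).2 hx
  have := isLocalRing_quotient hxm
  obtain ⟨s, hcard, hs⟩ := exists_finset_maximalIdeal_quotient_singleton hx hx2
  have hsd : (maximalIdeal R).spanFinrank = d := by
    have := IsRegularLocalRing.spanFinrank_maximalIdeal (R := R)
    rw [hd] at this
    exact_mod_cast this
  have hm : maximalIdeal (R ⧸ Ideal.span {x}) =
      Ideal.span ((s.image (Ideal.Quotient.mk (Ideal.span {x})) : Finset _) : Set _) := by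
    rw [← map_maximalIdeal_of_surjective (Ideal.Quotient.mk (Ideal.span {x}))
      Ideal.Quotient.mk_surjective]
    conv_lhs => rw [hs]
    rw [Ideal.map_sup, Ideal.map_quotient_self, sup_bot_eq, Ideal.map_span, Finset.coe_image]
  have hle : (maximalIdeal (R ⧸ Ideal.span {x})).spanFinrank ≤ s.card := by
    rw [hm]
    refine (Submodule.spanFinrank_span_le_ncard_of_finite (Finset.finite_toSet _)).trans ?_
    rw [Set.ncard_coe_finset]
    exact Finset.card_image_le
  have hdim : ringKrullDim R ≤ ringKrullDim (R ⧸ Ideal.span {x}) + 1 := by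
    rw [← maximalIdeal_height_eq_ringKrullDim]
    exact Ideal.height_le_ringKrullDim_quotient_add_one hx
  have hreg : IsRegularLocalRing (R ⧸ Ideal.span {x}) := by
    refine IsRegularLocalRing.of_spanFinrank_maximalIdeal_le _ ?_
    refine le_trans (Nat.cast_le.2 hle) ?_
    rw [hd, ← hsd, ← hcard] at hdim
    push_cast at hdim
    exact (ENat.WithBot.add_le_add_one_right_iff).1 hdim
  refine ⟨hreg, _, ?_, hreg.spanFinrank_maximalIdeal.symm⟩
  omega

/-- By prime avoidance either `𝔪 = 0` or some `x ∈ 𝔪` avoids `𝔪²` and all minimal primes. By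
induction `(x)` is then prime; a minimal prime `p ⊆ (x)` does not contain `x`, so `p = x p` and
Nakayama gives `p = 0`. -/
theorem isDomain_of_isRegularLocalRing_of_dim (d : ℕ) : ∀ (R : Type u) [CommRing R]
    [IsRegularLocalRing R], ringKrullDim R = d → IsDomain R := by
  induction d using Nat.strong_induction_on with
  | _ d ih =>
  intro R _ _ hd
  have hfg : (maximalIdeal R).FG := (maximalIdeal R).fg_of_isNoetherianRing
  suffices h : (⊥ : Ideal R).IsPrime from IsDomain.of_bot_isPrime R
  have hbot : maximalIdeal R = ⊥ → (⊥ : Ideal R).IsPrime := fun h => h ▸ inferInstance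
  by_cases hcover : (maximalIdeal R : Set R) ⊆
      ⋃ I ∈ insert (maximalIdeal R ^ 2) (minimalPrimes R), ((id I : Ideal R) : Set R)
  · obtain ⟨I, hI, hle⟩ := (Ideal.subset_union_prime_finite (f := id)
      ((minimalPrimes.finite_of_isNoetherianRing R).insert _) (maximalIdeal R ^ 2)
      (maximalIdeal R ^ 2)
      (fun I hI h _ => ((Set.mem_insert_iff.1 hI).resolve_left h).1.1)).1 hcover
    rcases Set.mem_insert_iff.1 hI with rfl | hI
    · refine hbot (le_bot_iff.1 (Submodule.le_of_le_smul_of_le_jacobson_bot hfg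
        (maximalIdeal_le_jacobson ⊥) ?_))
      rw [bot_sup_eq, smul_eq_mul, ← pow_two]
      exact hle
    · have hIp : I.IsPrime := hI.1.1
      have he : maximalIdeal R = I := le_antisymm hle (le_maximalIdeal hIp.ne_top)
      have h0 : (maximalIdeal R).height = 0 := by
        rw [Ideal.height_eq_zero_iff, he]
        exact hI
      have h1 := IsRegularLocalRing.spanFinrank_maximalIdeal (R := R)
      rw [← maximalIdeal_height_eq_ringKrullDim, h0] at h1
      have h2 : (maximalIdeal R).spanFinrank = 0 := by exact_mod_cast h1
      exact hbot ((Submodule.spanFinrank_eq_zero_iff_eq_bot hfg).1 h2)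
  · obtain ⟨x, hx, hx'⟩ := Set.not_subset.1 hcover
    simp only [Set.mem_iUnion, not_exists] at hx'
    have hx2 : x ∉ maximalIdeal R ^ 2 := hx' _ (Set.mem_insert _ _)
    obtain ⟨hreg, e, he, hde⟩ := isRegularLocalRing_quotient_singleton hd hx hx2
    have := ih e he _ hde
    have : (Ideal.span {x}).IsPrime := (Ideal.Quotient.isDomain_iff_prime _).1 inferInstance
    obtain ⟨p, hp, hpx⟩ := Ideal.exists_minimalPrimes_le (bot_le (a := Ideal.span {x}))
    have hpp : p.IsPrime := hp.1.1
    have hxp : x ∉ p := hx' p (Set.mem_insert_of_mem _ hp)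
    have : p = ⊥ := by
      refine le_bot_iff.1 (Submodule.le_of_le_smul_of_le_jacobson_bot p.fg_of_isNoetherianRing
        (maximalIdeal_le_jacobson ⊥) ?_)
      rw [bot_sup_eq, smul_eq_mul]
      intro y hy
      obtain ⟨a, rfl⟩ := Ideal.mem_span_singleton.1 (hpx hy)
      exact Ideal.mul_mem_mul hx ((hpp.mem_or_mem hy).resolve_left hxp)
    exact this ▸ hpp

theorem exists_ringKrullDim_eq (R : Type u) [CommRing R] [IsRegularLocalRing R] :
    ∃ d : ℕ, ringKrullDim R = d :=
  ⟨_, IsRegularLocalRing.spanFinrank_maximalIdeal.symm⟩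

theorem spanFinrank_maximalIdeal_le_of_ker_le {R : Type u} {T : Type v} [CommRing R] [CommRing T]
    [IsLocalRing R] [IsNoetherianRing R] [IsLocalRing T] [IsNoetherianRing T] (π : R →+* T)
    (hπ : Function.Surjective π) (hker : RingHom.ker π ≤ maximalIdeal R ^ 2) :
    (maximalIdeal R).spanFinrank ≤ (maximalIdeal T).spanFinrank := by
  classical
  obtain ⟨s, hcard, hs⟩ := Submodule.FG.exists_span_finset_card_eq_spanFinrank
    (maximalIdeal T).fg_of_isNoetherianRing
  have := hπ.isLocalHom π
  let t : Finset R := s.image (Function.surjInv hπ)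
  have ht : (Ideal.span (t : Set R)).map π = maximalIdeal T := by
    rw [Ideal.map_span, ← hs]
    congr 1
    rw [Finset.coe_image, ← Set.image_comp]
    convert Set.image_id _
    ext y
    exact Function.surjInv_eq hπ y
  have hle : maximalIdeal R ≤ Ideal.span (t : Set R) := by
    refine Submodule.le_of_le_smul_of_le_jacobson_bot (maximalIdeal R).fg_of_isNoetherianRing
      (maximalIdeal_le_jacobson ⊥) ?_
    rw [smul_eq_mul, ← pow_two]
    have h1 : maximalIdeal R ≤ ((Ideal.span (t : Set R)).map π).comap π := by
      rw [ht, maximalIdeal_comap]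
    rw [Ideal.comap_map_of_surjective π hπ] at h1
    exact h1.trans (sup_le_sup_left hker _)
  have heq : maximalIdeal R = Ideal.span (t : Set R) := by
    refine le_antisymm hle ?_
    rw [← maximalIdeal_comap π, ← ht]
    exact Ideal.le_comap_map
  rw [heq, ← hcard]
  refine (Submodule.spanFinrank_span_le_ncard_of_finite (Finset.finite_toSet _)).trans ?_
  rw [Set.ncard_coe_finset]
  exact Finset.card_image_le

/-- If the kernel lies in `𝔪²`, both rings have the same embedding dimension, hence the same
dimension, and the kernel of a domain onto such a quotient is zero. Otherwise divide by some `x` in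
the kernel outside `𝔪²` and induct. -/
theorem mem_mul_ker_of_dim (d : ℕ) : ∀ (R : Type u) (T : Type v) [CommRing R] [CommRing T]
    [IsRegularLocalRing R] [IsRegularLocalRing T], ringKrullDim R = d → ∀ π : R →+* T,
    Function.Surjective π → ∀ p ∈ RingHom.ker π, p ∈ maximalIdeal R ^ 2 →
      p ∈ maximalIdeal R * RingHom.ker π := by
  induction d using Nat.strong_induction_on with
  | _ d ih =>
  intro R T _ _ _ _ hd π hπ p hp hp2
  by_cases hker : RingHom.ker π ≤ maximalIdeal R ^ 2
  · have := isDomain_of_isRegularLocalRing_of_dim d R hd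
    rcases eq_or_ne p 0 with rfl | hp0
    · exact zero_mem _
    exfalso
    have h1 := ringKrullDim_succ_le_of_surjective π hπ (mem_nonZeroDivisors_of_ne_zero hp0) hp
    have h2 := spanFinrank_maximalIdeal_le_of_ker_le π hπ hker
    rw [← IsRegularLocalRing.spanFinrank_maximalIdeal,
      ← IsRegularLocalRing.spanFinrank_maximalIdeal] at h1
    have h3 : (maximalIdeal T).spanFinrank + 1 ≤ (maximalIdeal R).spanFinrank := by
      exact_mod_cast h1
    omega
  · obtain ⟨x, hxk, hx2⟩ := SetLike.not_le_iff_exists.1 hker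
    have hle : RingHom.ker π ≤ maximalIdeal R := le_maximalIdeal (RingHom.ker_ne_top π)
    have hx := hle hxk
    obtain ⟨hreg, e, he, hde⟩ := isRegularLocalRing_quotient_singleton hd hx hx2
    have hlift : ∀ a ∈ Ideal.span {x}, π a = 0 :=
      (Ideal.span_singleton_le_iff_mem (I := RingHom.ker π)).2 hxk
    have key := ih e he _ T hde (Ideal.Quotient.lift (Ideal.span {x}) π hlift)
      (Ideal.Quotient.lift_surjective_of_surjective _ _ hπ) (Ideal.Quotient.mk _ p)
      (by simpa using hp)
      (by
        rw [← map_maximalIdeal_of_surjective (Ideal.Quotient.mk (Ideal.span {x}))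
          Ideal.Quotient.mk_surjective, ← Ideal.map_pow]
        exact Ideal.mem_map_of_mem _ hp2)
    have hk : RingHom.ker (Ideal.Quotient.lift (Ideal.span {x}) π hlift) =
        (RingHom.ker π).map (Ideal.Quotient.mk (Ideal.span {x})) :=
      Ideal.ker_quotient_lift π hlift
    rw [← map_maximalIdeal_of_surjective (Ideal.Quotient.mk (Ideal.span {x}))
      Ideal.Quotient.mk_surjective, hk, ← Ideal.map_mul,
      Ideal.mem_quotient_iff_mem_sup] at key
    obtain ⟨q, hq, y, hy, rfl⟩ := Submodule.mem_sup.1 key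
    obtain ⟨a, rfl⟩ := Ideal.mem_span_singleton'.1 hy
    -- The coefficient `a` lies in `𝔪`: were it a unit, `a * x ∈ 𝔪²` would force `x ∈ 𝔪²`.
    refine add_mem hq (Ideal.mul_mem_mul ?_ hxk)
    by_contra ha
    have hax : a * x ∈ maximalIdeal R ^ 2 := by
      refine ((maximalIdeal R ^ 2).add_mem_iff_right ?_).1 hp2
      rw [pow_two]
      exact Ideal.mul_mono_right hle hq
    exact hx2 ((Ideal.unit_mul_mem_iff_mem _ (by simpa using ha)).1 hax)

/-- If `R` is a regular local ring with a regular quotient `T`, then the kernel `K` of `R → T`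
satisfies `K ∩ 𝔪² = 𝔪K`. -/
theorem mem_mul_ker_of_isRegularLocalRing {R : Type u} {T : Type v} [CommRing R] [CommRing T]
    [IsRegularLocalRing R] [IsRegularLocalRing T] {π : R →+* T} (hπ : Function.Surjective π)
    {p : R} (hp : π p = 0) (hp2 : p ∈ maximalIdeal R ^ 2) :
    p ∈ maximalIdeal R * RingHom.ker π :=
  (exists_ringKrullDim_eq R).elim fun d hd => mem_mul_ker_of_dim d R T hd π hπ p hp hp2

/-- Let `A / J` be regular at `𝔪` and let `I ⊆ J` have the same image as `J` in `𝔪 / 𝔪²`. Then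
`I ∩ 𝔪²` and `𝔪I` agree locally at `𝔪`. -/
theorem exists_mul_mem_mul_of_isRegularLocalRing {A : Type u} [CommRing A] [IsRegularRing A]
    {J I : Ideal A} (m : Ideal (A ⧸ J)) [m.IsPrime] [IsRegularLocalRing (Localization.AtPrime m)]
    (hIJ : I ≤ J)
    (hJ : ∀ b ∈ J, ∃ b' ∈ I, b - b' ∈ m.comap (Ideal.Quotient.mk J) ^ 2)
    {p : A} (hp : p ∈ J) (hp2 : p ∈ m.comap (Ideal.Quotient.mk J) ^ 2) :
    ∃ s ∉ m.comap (Ideal.Quotient.mk J), s * p ∈ m.comap (Ideal.Quotient.mk J) * I := by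
  set n := m.comap (Ideal.Quotient.mk J) with hn
  let R := Localization.AtPrime n
  let π : R →+* Localization.AtPrime m :=
    Localization.localRingHom n m (Ideal.Quotient.mk J) rfl
  have hπ : Function.Surjective π :=
    RingHom.surjective_localRingHom_of_surjective _ Ideal.Quotient.mk_surjective m
  have hπa : ∀ a : A, π (algebraMap A R a) = algebraMap _ _ (Ideal.Quotient.mk J a) :=
    fun a => Localization.localRingHom_to_map n m _ rfl a
  have hmax : n.map (algebraMap A R) = maximalIdeal R := Localization.AtPrime.map_eq_maximalIdeal
  have hmap2 : ∀ a ∈ n ^ 2, algebraMap A R a ∈ maximalIdeal R ^ 2 := fun a ha => by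
    rw [← hmax, ← Ideal.map_pow]
    exact Ideal.mem_map_of_mem _ ha
  have hJk : ∀ a ∈ J, algebraMap A R a ∈ RingHom.ker π := fun a ha => by
    rw [RingHom.mem_ker, hπa, Ideal.Quotient.eq_zero_iff_mem.2 ha, map_zero]
  have hkJ : RingHom.ker π ≤ J.map (algebraMap A R) := by
    intro y hy
    obtain ⟨a, s, rfl⟩ := IsLocalization.exists_mk'_eq n.primeCompl y
    rw [RingHom.mem_ker] at hy
    have h0 : π (algebraMap A R a) = 0 := by
      rw [← IsLocalization.mk'_spec R a s, map_mul, hy, zero_mul]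
    rw [hπa, IsLocalization.map_eq_zero_iff m.primeCompl] at h0
    obtain ⟨⟨t, ht⟩, hta⟩ := h0
    obtain ⟨t, rfl⟩ := Ideal.Quotient.mk_surjective t
    rw [← map_mul, Ideal.Quotient.eq_zero_iff_mem] at hta
    rw [IsLocalization.mk'_mem_map_algebraMap_iff]
    exact ⟨t, ht, hta⟩
  -- Nakayama: each `b ∈ J` differs from some `b' ∈ I` by an element of `ker π ∩ 𝔪² = 𝔪 ker π`.
  have hkI : RingHom.ker π ≤ I.map (algebraMap A R) := by
    refine Submodule.le_of_le_smul_of_le_jacobson_bot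
      (RingHom.ker π).fg_of_isNoetherianRing (maximalIdeal_le_jacobson ⊥)
      (hkJ.trans (Ideal.map_le_iff_le_comap.2 fun b hb => ?_))
    obtain ⟨b', hb', hbb⟩ := hJ b hb
    rw [Ideal.mem_comap, ← add_sub_cancel b' b, map_add]
    exact add_mem (Ideal.mem_sup_left (Ideal.mem_map_of_mem _ hb'))
      (Ideal.mem_sup_right (mem_mul_ker_of_isRegularLocalRing hπ
        (hJk _ (sub_mem hb (hIJ hb'))) (hmap2 _ hbb)))
  have h1 : algebraMap A R p ∈ (n * I).map (algebraMap A R) := by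
    rw [Ideal.map_mul, hmax]
    exact Ideal.mul_mono_right hkI (mem_mul_ker_of_isRegularLocalRing hπ (hJk p hp) (hmap2 p hp2))
  rw [IsLocalization.algebraMap_mem_map_algebraMap_iff n.primeCompl] at h1
  exact h1

end RegularLocal

/-! ### Extreme states are multiplicative -/

section Multiplicative

variable {A : Type*} [CommRing A] {S : Subsemiring A}

theorem mul_mem_of_mem {M : Submodule S A} {s p : A} (hs : s ∈ S) (hp : p ∈ M) : s * p ∈ M :=
  M.smul_mem (⟨s, hs⟩ : S) hp

/-- The elements of `A` acting on the additive functional `φ` as multiplication by the value of `φ`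
at their product with `u`. -/
def multiplierSubgroup {I : Ideal A} (φ : I →+ ℝ) (u : I) : AddSubgroup A where
  carrier := {a | ∀ b, φ (a • b) = φ (a • u) * φ b}
  add_mem' ha hb c := by
    simp only [add_smul, map_add, ha c, hb c, add_mul]
  zero_mem' _ := by simp
  neg_mem' ha b := by simp only [neg_smul, map_neg, ha b, neg_mul]

theorem mem_multiplierSubgroup {I : Ideal A} {φ : I →+ ℝ} {u : I} {a : A} :
    a ∈ multiplierSubgroup φ u ↔ ∀ b, φ (a • b) = φ (a • u) * φ b := Iff.rfl

theorem sum_isOrderUnit {M : Submodule S A} {r : ℕ} {g : Fin r → A} (hg : ∀ i, g i ∈ S)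
    (hMarch : IsArchimedean (M : Set A)) (hM1 : (1 : A) ∈ M) {p : A}
    (hp : p ∈ Ideal.span (Set.range g)) : ∃ N : ℕ, (N : A) * ∑ i, g i - p ∈ M := by
  obtain ⟨a, rfl⟩ := Ideal.mem_span_range_iff_exists_fun.1 hp
  choose N hN using fun i => hMarch (a i)
  refine ⟨∑ i, N i, ?_⟩
  -- Each term is `gᵢ ∈ S` times an element of `M`, which is why the `gᵢ` must lie in `S`.
  have e : ((∑ i, N i : ℕ) : A) * ∑ i, g i - ∑ i, a i * g i =
      ∑ i, g i * (((∑ j, N j : ℕ) : A) - a i) := by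
    rw [Finset.mul_sum, ← Finset.sum_sub_distrib]
    exact Finset.sum_congr rfl fun i _ => by ring
  rw [e]
  refine sum_mem fun i _ => mul_mem_of_mem (hg i) ?_
  have hle : N i ≤ ∑ j, N j := Finset.single_le_sum (fun _ _ => Nat.zero_le _) (Finset.mem_univ i)
  obtain ⟨k, hk⟩ := Nat.exists_eq_add_of_le hle
  have e2 : ((∑ j, N j : ℕ) : A) - a i = (N i - a i) + k • (1 : A) := by
    rw [hk, nsmul_eq_mul]; push_cast; ring
  rw [e2]
  exact add_mem (hN i) (nsmul_mem hM1 k)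

variable [Algebra ℚ A]

/-- The cone `M ∩ I` in the ideal `I`. -/
def idealCone (M : Submodule S A) (hM : ∀ q : ℚ, 0 ≤ q → ∀ p ∈ M, q • p ∈ M) (I : Ideal A) :
    PointedCone ℚ I where
  carrier := {b | (b : A) ∈ M}
  add_mem' ha hb := M.add_mem ha hb
  zero_mem' := M.zero_mem
  smul_mem' q _ hb := hM q.1 q.2 _ hb

variable {M : Submodule S A} {hM : ∀ q : ℚ, 0 ≤ q → ∀ p ∈ M, q • p ∈ M} {I : Ideal A}

theorem mem_idealCone {b : I} : b ∈ idealCone M hM I ↔ (b : A) ∈ M := Iff.rfl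

theorem smul_mem_idealCone {s : A} {b : I} (hs : s ∈ S) (hb : b ∈ idealCone M hM I) :
    s • b ∈ idealCone M hM I :=
  mul_mem_of_mem (M := M) hs hb

/-- The functional `b ↦ φ (a b)` is positive and dominated by `N φ`, hence a multiple of the extreme
state `φ`. -/
theorem mem_multiplierSubgroup_of_pos {φ : I →+ ℝ} {u : I}
    (hu : ∀ x, ∃ N : ℕ, (N : ℚ) • u - x ∈ idealCone M hM I) (huC : u ∈ idealCone M hM I)
    (hφ : (φ : I → ℝ) ∈ (states (idealCone M hM I) u).extremePoints ℝ) {a : A} {N : ℕ}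
    (hN : 0 < N) (ha : ∀ c ∈ idealCone M hM I, 0 ≤ φ (a • c))
    (hNa : ∀ c ∈ idealCone M hM I, 0 ≤ φ (((N : A) - a) • c)) : a ∈ multiplierSubgroup φ u := by
  refine eq_mul_of_dominated hu huC hφ (ψ := fun b => φ (a • b)) (t := N) (by exact_mod_cast hN)
    (fun x y => by rw [smul_add, map_add]) ha fun c hc => ?_
  have := hNa c hc
  rw [sub_smul, map_sub, Nat.cast_smul_eq_nsmul, map_nsmul, nsmul_eq_mul] at this
  linarith

theorem multiplierSubgroup_eq_top_of_isArchimedean {φ : I →+ ℝ} {u : I}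
    (hS : IsArchimedean (S : Set A))
    (hu : ∀ x, ∃ N : ℕ, (N : ℚ) • u - x ∈ idealCone M hM I) (huC : u ∈ idealCone M hM I)
    (hφ : (φ : I → ℝ) ∈ (states (idealCone M hM I) u).extremePoints ℝ) :
    multiplierSubgroup φ u = ⊤ := by
  have hnn : ∀ s ∈ S, ∀ c ∈ idealCone M hM I, 0 ≤ φ (s • c) := fun s hs c hc =>
    hφ.1.2.1 _ (smul_mem_idealCone hs hc)
  have hSG : ∀ s ∈ S, s ∈ multiplierSubgroup φ u := by
    intro s hs
    obtain ⟨N, hN⟩ := hS s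
    refine mem_multiplierSubgroup_of_pos hu huC hφ N.succ_pos (hnn s hs) (hnn _ ?_)
    have : ((N + 1 : ℕ) : A) - s = (N - s) + 1 := by push_cast; ring
    rw [Nat.succ_eq_add_one, this]
    exact add_mem hN S.one_mem
  refine (AddSubgroup.eq_top_iff' _).2 fun a => ?_
  obtain ⟨N, hN⟩ := hS a
  rw [← sub_sub_cancel (N : A) a]
  exact sub_mem (hSG _ (natCast_mem S N)) (hSG _ hN)

theorem convex_bounded_seq_le {s : ℕ → ℝ} {K : ℝ} (hconv : ∀ j, 0 ≤ s (j + 2) - 2 * s (j + 1) + s j)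
    (hK : ∀ j, s j ≤ K) : s 1 ≤ s 0 := by
  have hmono : ∀ j, s 1 - s 0 ≤ s (j + 1) - s j := by
    intro j
    induction j with
    | zero => rfl
    | succ j ih => linarith [hconv j]
  have hlin : ∀ j : ℕ, s 0 + j * (s 1 - s 0) ≤ s j := by
    intro j
    induction j with
    | zero => simp
    | succ j ih =>
      push_cast
      linarith [hmono j]
  by_contra! h
  obtain ⟨j, hj⟩ := exists_nat_gt ((K - s 0) / (s 1 - s 0))
  rw [div_lt_iff₀ (sub_pos.2 h)] at hj
  linarith [hlin j, hK j]

/-- Here `1 - b²` lies only in `M`, so multiplying `c ∈ M` by it may leave `M`. Instead `j ↦ φ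
(b^(2j) c)` is convex, because `(b^j (1 - b²))²` is in `S`, and bounded above, because `c ≤ K u` and
`φ (b^(2j) u) ≤ 1`; the latter uses `u ∈ S`. Such a sequence cannot increase. -/
theorem apply_sq_smul_le {φ : I →+ ℝ} {u : I} (hS : IsPreordering S)
    (hu : ∀ x, ∃ N : ℕ, (N : ℚ) • u - x ∈ idealCone M hM I) (huS : (u : A) ∈ S)
    (hφ : (φ : I → ℝ) ∈ states (idealCone M hM I) u) {b : A} (hb : 1 - b ^ 2 ∈ M) {c : I}
    (hc : c ∈ idealCone M hM I) : φ (b ^ 2 • c) ≤ φ c := by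
  obtain ⟨-, hpos, hφu⟩ := hφ
  have hsq : ∀ a : A, a ^ 2 ∈ S := fun a => hS _ (by rw [pow_two]; exact IsSumSq.mul_self a)
  have hpow : ∀ j : ℕ, (b ^ 2) ^ j ∈ S := fun j => pow_mem (hsq b) j
  have hbu : ∀ j : ℕ, φ ((b ^ 2) ^ j • u) ≤ 1 := by
    intro j
    induction j with
    | zero => simp [hφu]
    | succ j ih =>
      refine le_trans ?_ ih
      rw [← sub_nonneg, ← map_sub]
      refine hpos _ (mem_idealCone.2 ?_)
      have e : (((b ^ 2) ^ j • u - (b ^ 2) ^ (j + 1) • u : I) : A) =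
          ((b ^ 2) ^ j * u) * (1 - b ^ 2) := by
        push_cast
        simp only [smul_eq_mul]
        ring
      rw [e]
      exact mul_mem_of_mem (mul_mem (hpow j) huS) hb
  obtain ⟨K, hK⟩ := hu c
  have key := convex_bounded_seq_le (s := fun j => φ ((b ^ 2) ^ j • c)) (K := K) ?_ ?_
  · simpa using key
  · intro j
    have h := hpos _ (smul_mem_idealCone (hsq (b ^ j * (1 - b ^ 2))) hc)
    have e : (b ^ j * (1 - b ^ 2)) ^ 2 • c =
        (b ^ 2) ^ (j + 2) • c - (2 : ℕ) • ((b ^ 2) ^ (j + 1) • c) + (b ^ 2) ^ j • c := by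
      rw [← Nat.cast_smul_eq_nsmul A, smul_smul, ← sub_smul, ← add_smul]
      congr 1
      push_cast
      ring
    rw [e, map_add, map_sub, map_nsmul, nsmul_eq_mul] at h
    exact_mod_cast h
  · intro j
    have h := hpos _ (smul_mem_idealCone (hpow j) hK)
    rw [smul_sub, smul_comm, map_sub, Nat.cast_smul_eq_nsmul, map_nsmul, nsmul_eq_mul] at h
    have h2 := mul_le_mul_of_nonneg_left (hbu j) (Nat.cast_nonneg (α := ℝ) K)
    change φ ((b ^ 2) ^ j • c) ≤ K
    linarith

theorem multiplierSubgroup_eq_top_of_isPreordering {φ : I →+ ℝ} {u : I}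
    (hS : IsPreordering S) (hM1 : (1 : A) ∈ M) (hMarch : IsArchimedean (M : Set A))
    (hu : ∀ x, ∃ N : ℕ, (N : ℚ) • u - x ∈ idealCone M hM I) (huC : u ∈ idealCone M hM I)
    (huS : (u : A) ∈ S)
    (hφ : (φ : I → ℝ) ∈ (states (idealCone M hM I) u).extremePoints ℝ) :
    multiplierSubgroup φ u = ⊤ := by
  have hsq : ∀ a : A, a ^ 2 ∈ S := fun a => hS _ (by rw [pow_two]; exact IsSumSq.mul_self a)
  have hG1 : ∀ b : A, 1 - b ^ 2 ∈ M → b ^ 2 ∈ multiplierSubgroup φ u := by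
    intro b hb
    refine mem_multiplierSubgroup_of_pos hu huC hφ one_pos
      (fun c hc => hφ.1.2.1 _ (smul_mem_idealCone (hsq b) hc)) fun c hc => ?_
    rw [Nat.cast_one, sub_smul, one_smul, map_sub, sub_nonneg]
    exact apply_sq_smul_le hS hu huS hφ.1 hb hc
  -- Rescale `a` by `N + 1`, since `(N + 1)² ≥ N` makes `1 - (a / (N + 1))²` an element of `M`.
  have hG2 : ∀ a : A, a ^ 2 ∈ multiplierSubgroup φ u := by
    intro a
    obtain ⟨N, hN⟩ := hMarch (a ^ 2)
    have hN1 : (((N + 1) ^ 2 : ℕ) : A) - a ^ 2 ∈ M := by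
      have e : (((N + 1) ^ 2 : ℕ) : A) - a ^ 2 =
          (N - a ^ 2) + (N ^ 2 + N + 1 : ℕ) • (1 : A) := by
        rw [nsmul_eq_mul]; push_cast; ring
      rw [e]
      exact add_mem hN (nsmul_mem hM1 _)
    have hne : ((N : ℚ) + 1) ≠ 0 := by positivity
    have e1 : a = ((N + 1 : ℕ) : A) * (((N : ℚ) + 1)⁻¹ • a) := by
      rw [← nsmul_eq_mul, ← Nat.cast_smul_eq_nsmul ℚ, smul_smul]
      push_cast
      rw [mul_inv_cancel₀ hne, one_smul]
    have h1 : 1 - (((N : ℚ) + 1)⁻¹ • a) ^ 2 ∈ M := by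
      have := hM ((((N : ℚ) + 1)⁻¹) ^ 2) (by positivity) _ hN1
      convert this using 1
      rw [smul_pow, smul_sub]
      congr 1
      rw [Algebra.smul_def, ← map_natCast (algebraMap ℚ A), ← map_mul]
      rw [Nat.cast_pow, Nat.cast_add, Nat.cast_one, ← mul_pow, inv_mul_cancel₀ hne, one_pow,
        map_one]
    rw [e1, mul_pow, ← Nat.cast_pow, ← nsmul_eq_mul]
    exact nsmul_mem (hG1 _ h1) _
  refine (AddSubgroup.eq_top_iff' _).2 fun a => ?_
  -- Squares generate enough of the additive group, by polarization.
  have h4 : (4 : ℕ) • a ∈ multiplierSubgroup φ u := by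
    have : (4 : ℕ) • a = (a + 1) ^ 2 - (a - 1) ^ 2 := by
      rw [nsmul_eq_mul]; push_cast; ring
    rw [this]
    exact sub_mem (hG2 _) (hG2 _)
  intro b
  have := h4 b
  rw [smul_assoc, smul_assoc, map_nsmul, map_nsmul, nsmul_eq_mul, nsmul_eq_mul] at this
  push_cast at this
  linarith

/-- The extreme states of `(I, M ∩ I, u)` are eigenfunctionals for multiplication by `A`. -/
theorem exists_ringHom_of_extreme {φ : I →+ ℝ} {u : I}
    (hS : IsArchimedean (S : Set A) ∨ IsPreordering S) (hM1 : (1 : A) ∈ M)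
    (hMarch : IsArchimedean (M : Set A))
    (hu : ∀ x, ∃ N : ℕ, (N : ℚ) • u - x ∈ idealCone M hM I) (huC : u ∈ idealCone M hM I)
    (huS : (u : A) ∈ S)
    (hφ : (φ : I → ℝ) ∈ (states (idealCone M hM I) u).extremePoints ℝ) :
    ∃ Φ : A →+* ℝ, (∀ a b, φ (a • b) = Φ a * φ b) ∧ ∀ p ∈ M, 0 ≤ Φ p := by
  have htop : multiplierSubgroup φ u = ⊤ := hS.elim
    (fun h => multiplierSubgroup_eq_top_of_isArchimedean h hu huC hφ)
    (fun h => multiplierSubgroup_eq_top_of_isPreordering h hM1 hMarch hu huC huS hφ)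
  have key : ∀ a b, φ (a • b) = φ (a • u) * φ b := fun a =>
    mem_multiplierSubgroup.1 (htop ▸ AddSubgroup.mem_top a)
  refine ⟨{ toFun := fun a => φ (a • u)
            map_one' := by rw [one_smul]; exact hφ.1.2.2
            map_mul' := fun a b => by rw [mul_smul]; exact key a (b • u)
            map_zero' := by simp
            map_add' := fun a b => by rw [add_smul, map_add] }, key, fun p hp => ?_⟩
  refine hφ.1.2.1 _ (mem_idealCone.2 ?_)
  have : ((p • u : I) : A) = u * p := mul_comm _ _
  rw [this]
  exact mul_mem_of_mem huS hp

end Multiplicative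

/-! ### Gradients and functionals concentrated at a point -/

section Gradient

open MvPolynomial

variable {n : ℕ}

/-- The gradient at `z`. -/
noncomputable def gradAt (z : Fin n → ℝ) : MvPolynomial (Fin n) ℝ →ₗ[ℝ] (Fin n → ℝ) where
  toFun p i := eval z (pderiv i p)
  map_add' p q := by ext i; simp
  map_smul' c p := by ext i; simp [smul_eval]

theorem gradAt_apply (z : Fin n → ℝ) (p : MvPolynomial (Fin n) ℝ) (i : Fin n) :
    gradAt z p i = eval z (pderiv i p) := rfl

theorem gradAt_mul (z : Fin n → ℝ) (p q : MvPolynomial (Fin n) ℝ) :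
    gradAt z (p * q) = eval z p • gradAt z q + eval z q • gradAt z p := by
  ext i
  simp [gradAt_apply]

theorem hasLineDerivAt_eval (v z : Fin n → ℝ) (p : MvPolynomial (Fin n) ℝ) :
    HasLineDerivAt ℝ (fun x : Fin n → ℝ => eval x p) (gradAt z p ⬝ᵥ v) z v := by
  unfold HasLineDerivAt
  induction p using MvPolynomial.induction_on with
  | C a => simpa [gradAt, dotProduct] using hasDerivAt_const (0 : ℝ) a
  | add p q hp hq =>
    rw [map_add, add_dotProduct]
    simpa using hp.fun_add hq
  | mul_X p i hp =>
    have h1 : HasDerivAt (fun t : ℝ => z i + t * v i) (v i) 0 := by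
      simpa using ((hasDerivAt_id (0 : ℝ)).mul_const (v i)).const_add (z i)
    have h2 := hp.fun_mul h1
    have e : gradAt z (p * X i) ⬝ᵥ v = gradAt z p ⬝ᵥ v * (z i + 0 * v i) +
        eval (z + (0 : ℝ) • v) p * v i := by
      simp only [dotProduct, gradAt_apply, Derivation.leibniz, pderiv_X, smul_eq_mul, map_add,
        map_mul, eval_X, zero_mul, add_zero, zero_smul, add_mul, Finset.sum_add_distrib,
        Finset.sum_mul]
      rw [add_comm]
      congr 1
      · exact Finset.sum_congr rfl fun j _ => by ring
      · rw [Finset.sum_eq_single i]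
        · simp
        · intro j _ hj
          simp [Pi.single_eq_of_ne' hj]
        · simp
    rw [e]
    simpa using h2

theorem dirDeriv_eq (v z : Fin n → ℝ) (p : MvPolynomial (Fin n) ℝ) :
    dirDeriv v p z = gradAt z p ⬝ᵥ v :=
  (hasLineDerivAt_eval v z p).lineDeriv

theorem ker_eval_eq_span (z : Fin n → ℝ) :
    RingHom.ker (eval z) =
      Ideal.span (Set.range fun i => (X i - C (z i) : MvPolynomial (Fin n) ℝ)) := by
  set m := Ideal.span (Set.range fun i => (X i - C (z i) : MvPolynomial (Fin n) ℝ)) with hm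
  have key : ∀ p : MvPolynomial (Fin n) ℝ, p - C (eval z p) ∈ m := by
    intro p
    induction p using MvPolynomial.induction_on with
    | C a => simp
    | add p q hp hq =>
      have := add_mem hp hq
      convert this using 1
      simp only [map_add]; ring
    | mul_X p i hp =>
      have h := add_mem (m.mul_mem_right (X i) hp)
        (m.mul_mem_left (C (eval z p)) (Ideal.subset_span ⟨i, rfl⟩))
      convert h using 1
      simp only [map_mul, eval_X]; ring
  refine le_antisymm (fun p hp => ?_) (Ideal.span_le.2 ?_)
  · have := key p
    rwa [(RingHom.mem_ker).1 hp, map_zero, sub_zero] at this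
  · rintro _ ⟨i, rfl⟩
    simp

theorem mem_ker_eval_sq {z : Fin n → ℝ} {p : MvPolynomial (Fin n) ℝ} (h0 : eval z p = 0)
    (h1 : gradAt z p = 0) : p ∈ RingHom.ker (eval z) ^ 2 := by
  have hp : p ∈ RingHom.ker (eval z) := h0
  rw [ker_eval_eq_span] at hp
  obtain ⟨c, rfl⟩ := Ideal.mem_span_range_iff_exists_fun.1 hp
  rw [pow_two]
  refine sum_mem fun j _ => Ideal.mul_mem_mul ?_ (by simp)
  have h := congrFun h1 j
  rw [map_sum, Finset.sum_apply, Finset.sum_eq_single j] at h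
  · simpa [gradAt_apply] using h
  · intro i _ hi
    simp [gradAt_apply, Pi.single_eq_of_ne hi]
  · simp

/-- If every direction killed by the differentials of the `g i` is tangent to `J`, then the
differentials of the elements of `J` are combinations of those of the `g i`. -/
theorem exists_gradAt_eq {r : ℕ} {g : Fin r → MvPolynomial (Fin n) ℝ} {z : Fin n → ℝ}
    {b : MvPolynomial (Fin n) ℝ}
    (h : ∀ v, (∀ i, gradAt z (g i) ⬝ᵥ v = 0) → gradAt z b ⬝ᵥ v = 0) :
    ∃ b' ∈ Ideal.span (Set.range g), gradAt z b = gradAt z b' := by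
  have hspan := mem_span_of_iInf_ker_le_ker (𝕜 := ℝ)
    (L := fun i => dotProductEquiv ℝ (Fin n) (gradAt z (g i)))
    (K := dotProductEquiv ℝ (Fin n) (gradAt z b)) (by
      intro v hv
      simp only [Submodule.mem_iInf, LinearMap.mem_ker] at hv ⊢
      exact h v hv)
  obtain ⟨c, hc⟩ := (Submodule.mem_span_range_iff_exists_fun ℝ).1 hspan
  refine ⟨∑ i, c i • g i, sum_mem fun i _ => ?_, ?_⟩
  · rw [smul_eq_C_mul]
    exact Ideal.mul_mem_left _ _ (Ideal.subset_span ⟨i, rfl⟩)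
  · refine (dotProductEquiv ℝ (Fin n)).injective ?_
    rw [← hc]
    simp

/-- A functional on `I` on which polynomials act through their value at `z` is a directional
derivative at `z`, provided that `I ∩ 𝔪²` is locally contained in `𝔪I`. -/
theorem exists_eq_gradAt {I : Ideal (MvPolynomial (Fin n) ℝ)} {z : Fin n → ℝ} {φ : I →+ ℝ}
    (hφ : ∀ a b, φ (a • b) = eval z a * φ b) (hI : ∀ p ∈ I, eval z p = 0)
    (hloc : ∀ p ∈ I, p ∈ RingHom.ker (eval z) ^ 2 →
      ∃ s, eval z s ≠ 0 ∧ s * p ∈ RingHom.ker (eval z) * I) :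
    ∃ v : Fin n → ℝ, ∀ b : I, φ b = gradAt z (b : MvPolynomial (Fin n) ℝ) ⬝ᵥ v := by
  have hmI : ∀ p ∈ RingHom.ker (eval z) * I, ∀ hp : p ∈ I, φ ⟨p, hp⟩ = 0 := by
    intro p hp
    suffices h : ∃ h : p ∈ I, φ ⟨p, h⟩ = 0 from fun _ => h.2
    refine Submodule.mul_induction_on hp ?_ ?_
    · intro a ha b hb
      refine ⟨I.mul_mem_left a hb, (hφ a ⟨b, hb⟩).trans ?_⟩
      rw [(RingHom.mem_ker).1 ha, zero_mul]
    · rintro x y ⟨hx, hx0⟩ ⟨hy, hy0⟩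
      refine ⟨add_mem hx hy, ?_⟩
      have := map_add φ ⟨x, hx⟩ ⟨y, hy⟩
      rwa [hx0, hy0, add_zero] at this
  -- Real linearity of the additive map `φ` comes from applying `hφ` to constants.
  let ψ : I →ₗ[ℝ] ℝ :=
    { toFun := φ
      map_add' := map_add φ
      map_smul' := fun c b => by
        have := hφ (C c) b
        rw [eval_C] at this
        rw [RingHom.id_apply, smul_eq_mul, ← this]
        congr 1
        ext1
        simp [smul_eq_C_mul] }
  let D : I →ₗ[ℝ] (Fin n → ℝ) := gradAt z ∘ₗ (I.subtype.restrictScalars ℝ)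
  have hker : LinearMap.ker D ≤ LinearMap.ker ψ := by
    intro b hb
    obtain ⟨s, hs, hsb⟩ := hloc b b.2 (mem_ker_eval_sq (hI _ b.2) hb)
    have := hmI _ hsb (I.mul_mem_left s b.2)
    have h2 := hφ s b
    rw [LinearMap.mem_ker]
    refine (mul_eq_zero.1 (h2.symm.trans this)).resolve_left hs
  -- As `ψ` vanishes on the kernel of the gradient map, it factors through it and extends to all of
  -- `ℝⁿ`.
  obtain ⟨L, hL⟩ : ∃ L : (Fin n → ℝ) →ₗ[ℝ] ℝ, D.dualMap L = ψ := by
    rw [← LinearMap.mem_range, LinearMap.range_dualMap_eq_dualAnnihilator_ker,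
      Submodule.mem_dualAnnihilator]
    exact fun b hb => hker hb
  refine ⟨(dotProductEquiv ℝ (Fin n)).symm L, fun b => ?_⟩
  have h1 : φ b = L (D b) := (LinearMap.congr_fun hL b).symm
  rw [h1, dotProduct_comm]
  conv_lhs => rw [← (dotProductEquiv ℝ (Fin n)).apply_symm_apply L]
  rfl

end Gradient

/-! ### Evaluation points, nonsingular points and the theorem -/

section Main

open MvPolynomial

variable {n : ℕ}

theorem exists_eq_eval (Φ : MvPolynomial (Fin n) ℝ →+* ℝ) : ∃ z : Fin n → ℝ, Φ = eval z := by
  refine ⟨fun i => Φ (X i), MvPolynomial.ringHom_ext (fun r => ?_) fun i => by simp⟩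
  rw [eval_C]
  -- The only ring endomorphism of `ℝ` is the identity, so `Φ` is automatically `ℝ`-linear.
  exact RingHom.congr_fun (Subsingleton.elim (Φ.comp C) (RingHom.id ℝ)) r

theorem comap_pointIdeal (J : Ideal (MvPolynomial (Fin n) ℝ)) (z : Fin n → ℝ)
    (hz : ∀ p ∈ J, eval z p = 0) :
    (pointIdeal J z hz).comap (Ideal.Quotient.mk J) = RingHom.ker (eval z) := by
  ext p
  simp [pointIdeal]

theorem exists_mul_mem_of_isNonsingularPoint {V : Set (Fin n → ℝ)} {z : Fin n → ℝ}
    (h : IsNonsingularPoint V z) {I : Ideal (MvPolynomial (Fin n) ℝ)}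
    (hI : I ≤ vanishingIdeal ℝ V)
    (hJ : ∀ b ∈ vanishingIdeal ℝ V, ∃ b' ∈ I, gradAt z b = gradAt z b')
    {p : MvPolynomial (Fin n) ℝ} (hp : p ∈ I) (hp2 : p ∈ RingHom.ker (eval z) ^ 2) :
    ∃ s, eval z s ≠ 0 ∧ s * p ∈ RingHom.ker (eval z) * I := by
  obtain ⟨hz, hreg⟩ := h
  have hc := comap_pointIdeal _ z hz
  have key := exists_mul_mem_mul_of_isRegularLocalRing (pointIdeal _ z hz) hI (fun b hb => ?_)
    (hI hp) (by rwa [hc])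
  · rw [hc] at key
    exact key
  · obtain ⟨b', hb', e⟩ := hJ b hb
    rw [hc]
    refine ⟨b', hb', mem_ker_eval_sq ?_ (by rw [map_sub, e, sub_self])⟩
    rw [map_sub, hz b hb, hz b' (hI hb'), sub_zero]

end Main

end ArchPos

theorem mainTheorem1 {n r : ℕ}
    (S : Subsemiring (MvPolynomial (Fin n) ℝ))
    (M : Submodule S (MvPolynomial (Fin n) ℝ))
    (hM_one : (1 : MvPolynomial (Fin n) ℝ) ∈ M)
    (hM_rat : ∀ q : ℚ, 0 ≤ q → ∀ p ∈ M, MvPolynomial.C (q : ℝ) * p ∈ M)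
    (hM_arch : ArchPos.IsArchimedean (M : Set (MvPolynomial (Fin n) ℝ)))
    (hS : ArchPos.IsArchimedean (S : Set (MvPolynomial (Fin n) ℝ)) ∨ ArchPos.IsPreordering S)
    (f : MvPolynomial (Fin n) ℝ)
    (hf : ∀ x ∈ ArchPos.nonnegSet (M : Set (MvPolynomial (Fin n) ℝ)),
      0 ≤ MvPolynomial.eval x f)
    (V : Set (Fin n → ℝ))
    (hV : V = ArchPos.zariskiClosure
      (ArchPos.zeroSet f ∩ ArchPos.nonnegSet (M : Set (MvPolynomial (Fin n) ℝ))))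
    (g : Fin r → MvPolynomial (Fin n) ℝ)
    (hg_mem : ∀ i, g i ∈ S)
    (hg_zero : ∀ i, ∀ z ∈ ArchPos.zeroSet f ∩
      ArchPos.nonnegSet (M : Set (MvPolynomial (Fin n) ℝ)), MvPolynomial.eval z (g i) = 0)
    (hfg : f ∈ Ideal.span (Set.range g))
    (hderiv : ∀ z ∈ ArchPos.zeroSet f ∩
        ArchPos.nonnegSet (M : Set (MvPolynomial (Fin n) ℝ)),
      ∀ v : Fin n → ℝ, (∀ i, 0 ≤ ArchPos.dirDeriv v (g i) z) →
        v ∉ ArchPos.tangentSpace V z → 0 < ArchPos.dirDeriv v f z)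
    (hsmooth : ∀ z ∈ ArchPos.zeroSet f ∩
        ArchPos.nonnegSet (M : Set (MvPolynomial (Fin n) ℝ)),
      ArchPos.IsNonsingularPoint V z) :
    f ∈ M := by
  have hM : ∀ q : ℚ, 0 ≤ q → ∀ p ∈ M, q • p ∈ M := by
    intro q hq p hp
    have := hM_rat q hq p hp
    rwa [← MvPolynomial.smul_eq_C_mul, Rat.cast_smul_eq_qsmul] at this
  have hSM : ∀ s ∈ S, s ∈ M := fun s hs => by
    simpa using ArchPos.mul_mem_of_mem hs hM_one
  let I := Ideal.span (Set.range g)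
  have hgI : ∀ i, g i ∈ I := fun i => Ideal.subset_span ⟨i, rfl⟩
  let u : I := ⟨∑ i, g i, sum_mem fun i _ => hgI i⟩
  have huS : (u : MvPolynomial (Fin n) ℝ) ∈ S :=
    (sum_mem fun i _ => hg_mem i : ∑ i, g i ∈ S)
  let K := ArchPos.idealCone M hM I
  have hu : ∀ x : I, ∃ N : ℕ, (N : ℚ) • u - x ∈ K := by
    intro x
    obtain ⟨N, hN⟩ := ArchPos.sum_isOrderUnit hg_mem hM_arch hM_one x.2
    refine ⟨N, ArchPos.mem_idealCone.2 ?_⟩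
    rw [Nat.cast_smul_eq_nsmul]
    simpa [u, nsmul_eq_mul] using hN
  have hIV : I ≤ MvPolynomial.vanishingIdeal ℝ V := by
    refine Ideal.span_le.2 ?_
    rintro _ ⟨i, rfl⟩
    rw [hV]
    refine MvPolynomial.le_vanishingIdeal_zeroLocus _ ?_
    rw [MvPolynomial.mem_vanishingIdeal_iff]
    intro z hz
    simpa using hg_zero i z hz
  by_contra hfM
  obtain ⟨φ', hφ', hφf⟩ := ArchPos.exists_extreme_state_nonpos (C := K) (u := u) (f := ⟨f, hfg⟩)
    hu (hSM _ huS) hfM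
  let φ : I →+ ℝ := AddMonoidHom.mk' φ' hφ'.1.1
  have hpos : ∀ c ∈ K, 0 ≤ φ c := hφ'.1.2.1
  have hφu : φ u = 1 := hφ'.1.2.2
  replace hφf : φ ⟨f, hfg⟩ ≤ 0 := hφf
  obtain ⟨Φ, hΦ, hΦM⟩ := ArchPos.exists_ringHom_of_extreme (φ := φ) hS hM_one hM_arch hu
    (hSM _ huS) huS hφ'
  obtain ⟨z, rfl⟩ := ArchPos.exists_eq_eval Φ
  have hzX : z ∈ ArchPos.nonnegSet (M : Set (MvPolynomial (Fin n) ℝ)) := hΦM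
  rcases (hf z hzX).eq_or_lt with h0 | h0
  · have hz : z ∈ ArchPos.zeroSet f ∩ ArchPos.nonnegSet (M : Set (MvPolynomial (Fin n) ℝ)) :=
      ⟨h0.symm, hzX⟩
    obtain ⟨hzV, -⟩ := hsmooth z hz
    have hloc : ∀ p ∈ I, p ∈ RingHom.ker (MvPolynomial.eval z) ^ 2 →
        ∃ s, MvPolynomial.eval z s ≠ 0 ∧ s * p ∈ RingHom.ker (MvPolynomial.eval z) * I := by
      refine fun p hp hp2 => ArchPos.exists_mul_mem_of_isNonsingularPoint (hsmooth z hz) hIV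
        (fun b hb => ArchPos.exists_gradAt_eq fun v hv => ?_) hp hp2
      by_contra hne
      -- A direction killing all `dgᵢ` at `z` must be tangent: otherwise `D_v f > 0`, whereas `f ∈
      -- I` and `gᵢ z = 0` give `D_v f = 0`.
      have hlt := hderiv z hz v (fun i => by rw [ArchPos.dirDeriv_eq, hv i])
        fun hT => hne (by rw [← ArchPos.dirDeriv_eq]; exact hT b hb)
      obtain ⟨a, rfl⟩ := Ideal.mem_span_range_iff_exists_fun.1 hfg
      refine hlt.ne' ?_
      rw [ArchPos.dirDeriv_eq, map_sum, sum_dotProduct]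
      refine Finset.sum_eq_zero fun i _ => ?_
      rw [ArchPos.gradAt_mul, hg_zero i z hz, zero_smul, add_zero, smul_dotProduct, hv i, smul_zero]
    obtain ⟨v, hv⟩ := ArchPos.exists_eq_gradAt hΦ (fun p hp => hzV p (hIV hp)) hloc
    have hfv := hderiv z hz v (fun i => by
      rw [ArchPos.dirDeriv_eq, ← hv ⟨g i, hgI i⟩]
      exact hpos _ (hSM _ (hg_mem i))) fun hT => by
        have := hT u (hIV u.2)
        rw [ArchPos.dirDeriv_eq, ← hv u, hφu] at this
        exact one_ne_zero this
    rw [ArchPos.dirDeriv_eq, ← hv ⟨f, hfg⟩] at hfv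
    exact absurd hφf (not_le.2 hfv)
  -- Evaluate `φ (f u)` with either factor acting as the scalar.
  · have h1 := hΦ f u
    have h2 := hΦ u ⟨f, hfg⟩
    have e : f • u = (u : MvPolynomial (Fin n) ℝ) • (⟨f, hfg⟩ : I) := Subtype.ext (mul_comm _ _)
    rw [e, h2, hφu, mul_one] at h1
    have h3 : 0 ≤ MvPolynomial.eval z (u : MvPolynomial (Fin n) ℝ) := hΦM _ (hSM _ huS)
    have h4 := mul_nonpos_of_nonneg_of_nonpos h3 hφf
    linarith
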